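/- Let $k$ be an algebraically closed field of any characteristic, let $V=k^n$ be the natural module of $G=\mathrm{GL}_n$, and let $\underline G=G\ltimes V$, with product $(g_1,v_1)(g_2,v_2)=(g_1g_2,\,g_1v_2+v_1)$. It acts on its Lie algebra $\mathfrak{gl}_n\times V$ by the adjoint action $$\mathrm{Ad}(g,v)(X,w)=\bigl(gXg^{-1},\,-(gXg^{-1})v+gw\bigr).$$ Let $\lambda=(a_1\ge\cdots\ge a_t>0)=(b_1^{d_1}\cdots b_r^{d_r})$, with $b_1>\cdots>b_r$ and all $d_i>0$, be a partition of $n$. Let $J_\lambda$ be the nilpotent Jordan matrix with diagonal blocks of sizes $a_1,\dots,a_t$ (ones just above the diagonal), and let $v_i$ be the last standard basis vector that belongs to the $i$-th block, so that the vectors $J_\lambda^m v_i$ $(1\le i\le t,\ 0\le m<a_i)$ form a basis of $V$. For $q=d_1+\cdots+d_{j-1}$ with $1\le j\le r+1$ (so $q=0$ for $j=1$), put $u_j=v_{d_1+\cdots+d_j}$ if $j\le r$, and $u_{r+1}=0$. Let $\mathcal O_\lambda\subset\mathfrak{gl}_n$ be the $G$-orbit of $J_\lambda$ under conjugation, and let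 $\mathcal O_{\lambda[q]}\subset\mathfrak{gl}_n\times V$ be the $\underline G$-orbit of $(J_\lambda,u_j)$, the enhanced nilpotent orbit of type $\lambda[q]$. Then $$\dim\mathcal O_{\lambda[q]}=\dim\mathcal O_\lambda+(n-q),$$ where $\dim$ is the dimension as an algebraic variety. -/

import Mathlib

open scoped Matrix

namespace Enhanced

/-! ### Partitions and enhanced partitions -/

section Partitions

variable {n : ℕ}

/-- The parts `a₁ ≥ a₂ ≥ ⋯ ≥ a_t > 0` of a partition, as a decreasing list. -/
def rows (lam : n.Partition) : List ℕ := lam.parts.sort (· ≥ ·)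

/-- The number `t` of parts. -/
def numRows (lam : n.Partition) : ℕ := (rows lam).length

/-- The `i`-th part; `i` runs from `0`, so `row lam i` is `a_{i+1}`. -/
def row (lam : n.Partition) (i : Fin (numRows lam)) : ℕ := (rows lam).get i

/-- The different parts `b₁ > b₂ > ⋯ > b_r`, as a decreasing list. -/
def distinctRows (lam : n.Partition) : List ℕ := lam.parts.dedup.sort (· ≥ ·)

/-- The multiplicities `d₁, …, d_r` of the different parts `b₁ > ⋯ > b_r`. -/
def multiplicities (lam : n.Partition) : List ℕ :=
  (distinctRows lam).map (fun b => lam.parts.count b)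

/-- `lam[q]` is an enhanced partition: `q` is one of the sums `d₁ + ⋯ + d_j`, `0 ≤ j ≤ r`. -/
def IsEnhancedPartition (lam : n.Partition) (q : ℕ) : Prop :=
  ∃ j : ℕ, j ≤ (multiplicities lam).length ∧ q = ((multiplicities lam).take j).sum

theorem row_pos (lam : n.Partition) (i : Fin (numRows lam)) : 0 < row lam i := by
  have h : row lam i ∈ rows lam := List.get_mem _ _
  exact lam.parts_pos ((Multiset.mem_sort (r := (· ≥ ·))).1 h)

theorem sum_row (lam : n.Partition) : ∑ i, row lam i = n := by
  have h1 : ∑ i, row lam i = (rows lam).sum := by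
    have := Fin.sum_univ_getElem (rows lam)
    exact this
  have h2 : ((rows lam : List ℕ) : Multiset ℕ) = lam.parts := Multiset.sort_eq _ _
  rw [h1, ← Multiset.sum_coe, h2, lam.parts_sum]

/-- The boxes of the diagram, numbered row after row by `0, …, n - 1`. -/
def boxEquiv (lam : n.Partition) : (Σ i : Fin (numRows lam), Fin (row lam i)) ≃ Fin n :=
  finSigmaFinEquiv.trans (finCongr (sum_row lam))

/-- For `q < t`, the (zero-based) index of the last row whose length is that of row number `q`.
If `q = d₁ + ⋯ + d_{j-1}`, this is the row which has number `d₁ + ⋯ + d_j` when one counts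
from `1`. -/
def lastEqualRow (lam : n.Partition) (q : Fin (numRows lam)) : Fin (numRows lam) :=
  ⟨(Finset.univ.filter (fun i => row lam q ≤ row lam i)).card - 1, by
    have h : (Finset.univ.filter (fun i => row lam q ≤ row lam i)).card ≤ numRows lam := by
      simpa using Finset.card_le_univ (Finset.univ.filter (fun i => row lam q ≤ row lam i))
    have hq := q.2
    omega⟩

end Partitions

/-! ### The enhanced group `GL_n ⋉ kⁿ` and its adjoint action -/

/-- The underlying set `GL_n(k) × kⁿ` of the enhanced group of the natural module. -/
@[ext] structure EnhancedGL (n : ℕ) (k : Type*) [Field k] where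
  lin : GL (Fin n) k
  vec : Fin n → k

section Group

variable {n : ℕ} {k : Type*} [Field k]

/-- `(g₁, v₁) (g₂, v₂) = (g₁ g₂, g₁ v₂ + v₁)`. -/
instance : Mul (EnhancedGL n k) :=
  ⟨fun x y => ⟨x.lin * y.lin, (x.lin : Matrix (Fin n) (Fin n) k) *ᵥ y.vec + x.vec⟩⟩

instance : One (EnhancedGL n k) := ⟨⟨1, 0⟩⟩

instance : Inv (EnhancedGL n k) :=
  ⟨fun x => ⟨x.lin⁻¹, -(((x.lin⁻¹ : GL (Fin n) k) : Matrix (Fin n) (Fin n) k) *ᵥ x.vec)⟩⟩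

theorem mul_lin (x y : EnhancedGL n k) : (x * y).lin = x.lin * y.lin := rfl
theorem mul_vec (x y : EnhancedGL n k) :
    (x * y).vec = (x.lin : Matrix (Fin n) (Fin n) k) *ᵥ y.vec + x.vec := rfl
theorem one_lin : (1 : EnhancedGL n k).lin = 1 := rfl
theorem one_vec : (1 : EnhancedGL n k).vec = 0 := rfl
theorem inv_lin (x : EnhancedGL n k) : (x⁻¹).lin = x.lin⁻¹ := rfl
theorem inv_vec (x : EnhancedGL n k) : (x⁻¹).vec =
    -(((x.lin⁻¹ : GL (Fin n) k) : Matrix (Fin n) (Fin n) k) *ᵥ x.vec) := rfl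

instance : Group (EnhancedGL n k) :=
  Group.ofLeftAxioms
    (by
      intro x y z
      ext1
      · simp only [mul_lin, mul_assoc]
      · simp only [mul_vec, mul_lin, Units.val_mul, Matrix.mulVec_add, Matrix.mulVec_mulVec,
          add_assoc])
    (by
      intro x
      ext1
      · simp only [mul_lin, one_lin, one_mul]
      · simp only [mul_vec, one_vec, one_lin, Units.val_one, Matrix.one_mulVec, add_zero])
    (by
      intro x
      ext1
      · simp only [mul_lin, one_lin, inv_lin, inv_mul_cancel]
      · simp only [mul_vec, one_vec, inv_lin, inv_vec, add_neg_cancel])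

/-- The adjoint action on `gl_n`: `Ad(g) X = g X g⁻¹`. -/
def conj (g : GL (Fin n) k) (X : Matrix (Fin n) (Fin n) k) : Matrix (Fin n) (Fin n) k :=
  (g : Matrix (Fin n) (Fin n) k) * X * ((g⁻¹ : GL (Fin n) k) : Matrix (Fin n) (Fin n) k)

/-- The adjoint action on `gl_n × kⁿ`:
`Ad(g, v)(X, w) = (Ad(g) X, -(Ad(g) X) v + g w)`. -/
instance : SMul (EnhancedGL n k) (Matrix (Fin n) (Fin n) k × (Fin n → k)) :=
  ⟨fun x p => (conj x.lin p.1,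
    -(conj x.lin p.1 *ᵥ x.vec) + (x.lin : Matrix (Fin n) (Fin n) k) *ᵥ p.2)⟩

theorem smul_def (x : EnhancedGL n k) (p : Matrix (Fin n) (Fin n) k × (Fin n → k)) :
    x • p = (conj x.lin p.1,
      -(conj x.lin p.1 *ᵥ x.vec) + (x.lin : Matrix (Fin n) (Fin n) k) *ᵥ p.2) := rfl

theorem conj_one (X : Matrix (Fin n) (Fin n) k) : conj 1 X = X := by
  simp [conj]

theorem conj_mul (g h : GL (Fin n) k) (X : Matrix (Fin n) (Fin n) k) :
    conj (g * h) X = conj g (conj h X) := by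
  simp only [conj, mul_inv_rev, Units.val_mul, Matrix.mul_assoc]

theorem conj_mul_coe (g : GL (Fin n) k) (X : Matrix (Fin n) (Fin n) k) :
    conj g X * (g : Matrix (Fin n) (Fin n) k) = (g : Matrix (Fin n) (Fin n) k) * X := by
  rw [conj, Matrix.mul_assoc, ← Units.val_mul, inv_mul_cancel, Units.val_one, Matrix.mul_one]

instance : MulAction (EnhancedGL n k) (Matrix (Fin n) (Fin n) k × (Fin n → k)) where
  one_smul p := by
    simp [smul_def, one_lin, one_vec, conj_one]
  mul_smul x y p := by
    simp only [smul_def, mul_lin, mul_vec, conj_mul, Prod.mk.injEq, true_and, Units.val_mul,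
      Matrix.mulVec_add, Matrix.mulVec_neg, Matrix.mulVec_mulVec, conj_mul_coe, neg_add]
    abel

end Group

/-! ### Nilpotent orbits and enhanced nilpotent orbits -/

section Orbits

variable {n : ℕ} (k : Type*) [Field k]

/-- The nilpotent Jordan block of size `a`, with ones just above the diagonal. -/
def jordanBlock (a : ℕ) : Matrix (Fin a) (Fin a) k :=
  Matrix.of fun r c => if (c : ℕ) = (r : ℕ) + 1 then 1 else 0

/-- The nilpotent Jordan matrix `J_lam = diag(J_{a₁}, …, J_{a_t})`. -/
def jordanMatrix (lam : n.Partition) : Matrix (Fin n) (Fin n) k :=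
  Matrix.reindex (boxEquiv lam) (boxEquiv lam)
    (Matrix.blockDiagonal' fun i => jordanBlock k (row lam i))

/-- The generator `v_i` of the `i`-th Jordan string `v_i, J v_i, …, J^{a_i - 1} v_i` of
`J = J_lam`: the last standard basis vector that belongs to the `i`-th block. -/
def stringGenerator (lam : n.Partition) (i : Fin (numRows lam)) : Fin n → k :=
  Pi.single (boxEquiv lam ⟨i, ⟨row lam i - 1, Nat.sub_lt (row_pos lam i) one_pos⟩⟩) 1

/-- The vector of the representative of type `lam[q]`: if `q = d₁ + ⋯ + d_{j-1}`, it is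
`v_{d₁ + ⋯ + d_j}` for `j ≤ r` (that is, for `q < t`), and `0` for `j = r + 1`
(that is, for `q = t`). -/
def typeVector (lam : n.Partition) (q : ℕ) : Fin n → k :=
  if h : q < numRows lam then stringGenerator k lam (lastEqualRow lam ⟨q, h⟩) else 0

/-- The `GL_n`-orbit of `J_lam` in `gl_n`. -/
def nilpotentOrbit (lam : n.Partition) : Set (Matrix (Fin n) (Fin n) k) :=
  Set.range fun g : GL (Fin n) k => conj g (jordanMatrix k lam)

/-- The enhanced nilpotent orbit of type `lam[q]` in `gl_n × kⁿ`. -/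
def enhancedOrbit (lam : n.Partition) (q : ℕ) :
    Set (Matrix (Fin n) (Fin n) k × (Fin n → k)) :=
  MulAction.orbit (EnhancedGL n k) (jordanMatrix k lam, typeVector k lam q)

end Orbits

/-! ### Dimension -/

section Dimension

variable (k : Type*) [Field k] {E : Type*} [AddCommGroup E] [Module k E]

/-- The ring `k[E] / I(S)` of restrictions to `S` of the polynomial functions on the
finite-dimensional space `E`: the algebra of functions on `S` generated by the restrictions of
the linear forms. It is the coordinate ring of the Zariski closure of `S`. -/
def coordinateRing (S : Set E) : Subalgebra k (S → k) :=
  Algebra.adjoin k (Set.range fun f : Module.Dual k E => fun s : S => f s)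

/-- The dimension of a locally closed subset `S` of a finite-dimensional space, that is, of its
Zariski closure: the Krull dimension of the coordinate ring. -/
noncomputable def dimension (S : Set E) : WithBot ℕ∞ := ringKrullDim (coordinateRing k S)

end Dimension

end Enhanced

namespace Enhanced

/-! ### Krull dimension and transcendence degree -/

/-! Project the enhanced orbit to the orbit of `J`. Put `b = b_j`, or `b = 0` when `q = t`. The
vectors `w` with `(J, w)` in the enhanced orbit form a dense subset of `Im J + Ker J ^ b`.
Containment is `exists_of_mem_enhancedOrbit`; density holds because the centralizer of `J` moves
`u_j`, modulo `Im J`, to a general vector of that space (`exists_centralizer_mulVec_eq`). The space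
has codimension the number of rows longer than `b`, which is `q` (`card_row_gt`).

Instead of a fibre dimension theorem, transcendence degrees of generic points are compared. With `g`
generic in `GL_n` and `w` generic in `Im J + Ker J ^ b`, the coordinate rings of the two closures
are generated by the entries of `X = g J g⁻¹`, respectively of `X` and `y = g w` (`IsGenericPoint`).
It remains to see that `y` has transcendence degree `n - q` over `K = k(X)`. Upper bound: `X ^ b y`
lies in `Im X ^ (b + 1)`, so every row vector `m` over `K` with `m X ^ (b + 1) = 0` yields a linear
relation `(m X ^ b) y = 0`. There are `rank X ^ b - rank X ^ (b + 1) = q` independent ones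
(`finrank_span_mulVec_le`). Lower bound: over the larger field `k(g)`, the vector `y` determines
`w`, which has `n - q` independent coordinates. `trdeg_adjoin_eq_of_finrank_span_le` combines the
two bounds. -/

/-- Lying over and going up lift chains of primes to `S`; incomparability makes contraction strictly
monotone, so chains in `S` do not collapse in `R`. -/
theorem ringKrullDim_eq_of_isIntegral {R S : Type*} [CommRing R] [CommRing S] [Algebra R S]
    [FaithfulSMul R S] [Algebra.IsIntegral R S] : ringKrullDim R = ringKrullDim S := by
  apply le_antisymm
  · refine iSup_le fun l => ?_
    obtain ⟨P, _, _⟩ : Nonempty (l.head.asIdeal.primesOver S) := inferInstance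
    have : P.IsPrime := by assumption
    obtain ⟨L, hL, -⟩ := Ideal.exists_ltSeries_of_hasGoingUp (S := S) l P
    rw [← hL]
    exact le_iSup (fun p : LTSeries (PrimeSpectrum S) => (p.length : WithBot ℕ∞)) L
  · refine Order.krullDim_le_of_strictMono (PrimeSpectrum.comap (algebraMap R S)) ?_
    intro P Q h
    exact Ideal.IsIntegral.comap_lt_comap (R := R) h

universe u

/-- The Krull dimension of a finitely generated domain is its transcendence degree. -/
theorem exists_ringKrullDim_eq_trdeg {k B : Type u} [Field k] [CommRing B] [IsDomain B]
    [Algebra k B] [Algebra.FiniteType k B] :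
    ∃ s : ℕ, ringKrullDim B = (s : WithBot ℕ∞) ∧ Algebra.trdeg k B = s := by
  -- Noether normalization: `B` is integral over a polynomial ring in `s` variables, and both
  -- invariants of that ring equal `s`.
  obtain ⟨s, g, hg, hint⟩ := exists_integral_inj_algHom_of_fg k B
  algebraize [g.toRingHom]
  have : IsScalarTower k (MvPolynomial (Fin s) k) B :=
    IsScalarTower.of_algebraMap_eq fun x => (g.commutes x).symm
  have : FaithfulSMul (MvPolynomial (Fin s) k) B :=
    (faithfulSMul_iff_algebraMap_injective _ _).2 hg
  have : Algebra.IsIntegral (MvPolynomial (Fin s) k) B := ⟨hint⟩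
  refine ⟨s, ?_, ?_⟩
  · rw [← ringKrullDim_eq_of_isIntegral (R := MvPolynomial (Fin s) k),
      MvPolynomial.ringKrullDim_of_isNoetherianRing, ringKrullDim_eq_zero_of_field, zero_add]
    simp
  · rw [← trdeg_add_eq k (MvPolynomial (Fin s) k) (A := B),
      trdeg_eq_zero (R := MvPolynomial (Fin s) k) (A := B)]
    simp

theorem ringKrullDim_eq_add_of_trdeg {k B C : Type u} [Field k] [CommRing B] [IsDomain B]
    [Algebra k B] [Algebra.FiniteType k B] [CommRing C] [IsDomain C]
    [Algebra k C] [Algebra.FiniteType k C] {m : ℕ}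
    (h : Algebra.trdeg k C = Algebra.trdeg k B + m) :
    ringKrullDim C = ringKrullDim B + (m : WithBot ℕ∞) := by
  obtain ⟨s, hs, hs'⟩ := exists_ringKrullDim_eq_trdeg (k := k) (B := B)
  obtain ⟨t, ht, ht'⟩ := exists_ringKrullDim_eq_trdeg (k := k) (B := C)
  rw [hs', ht'] at h
  have : t = s + m := by exact_mod_cast h
  rw [hs, ht, this]
  norm_cast

open scoped IntermediateField.algebraAdjoinAdjoin in
theorem trdeg_algebraAdjoin {F L : Type u} [Field F] [Field L] [Algebra F L] (s : Set L) :
    Algebra.trdeg F (Algebra.adjoin F s) = Algebra.trdeg F (IntermediateField.adjoin F s) := by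
  rw [← trdeg_add_eq F (Algebra.adjoin F s) (A := IntermediateField.adjoin F s),
    trdeg_eq_zero (R := Algebra.adjoin F s) (A := IntermediateField.adjoin F s), add_zero]

/-- Transcendence degree of a finite family that spans an `m`-dimensional space over the small
field and generates an algebra of transcendence degree at least `m` over the big field. -/
theorem trdeg_adjoin_eq_of_finrank_span_le {K K' L : Type u} [Field K] [Field K'] [Field L]
    [Algebra K K'] [Algebra K L] [Algebra K' L] [IsScalarTower K K' L]
    {ι : Type*} [Finite ι] (y : ι → L) (m : ℕ)
    (h1 : Module.finrank K (Submodule.span K (Set.range y)) ≤ m)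
    (h2 : (m : Cardinal) ≤ Algebra.trdeg K' (Algebra.adjoin K' (Set.range y))) :
    Algebra.trdeg K (Algebra.adjoin K (Set.range y)) = m := by
  -- A `K`-basis of the span chosen among the `y i`; it has at most `m` elements.
  obtain ⟨b, hb, hsp, hli⟩ := exists_linearIndependent K (Set.range y)
  have hfin : b.Finite := (Set.finite_range y).subset hb
  have := hfin.fintype
  have hcard : Fintype.card b ≤ m := by
    have := finrank_span_set_eq_card hli
    rw [hsp] at this
    rw [Set.toFinset_card] at this
    omega
  -- The `y i` are `K`-combinations of `b`, so `b` generates the same algebra over every extension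
  -- of `K` inside `L`; needed for both `K` and `K'`.
  have key : ∀ (M : Type u) [Field M] [Algebra K M] [Algebra M L] [IsScalarTower K M L],
      Algebra.adjoin M b = Algebra.adjoin M (Set.range y) := by
    intro M _ _ _ _
    apply le_antisymm (Algebra.adjoin_mono hb)
    rw [Algebra.adjoin_le_iff]
    have : Submodule.span K b ≤
        (Subalgebra.toSubmodule (Algebra.adjoin M b)).restrictScalars K :=
      Submodule.span_le.2 Algebra.subset_adjoin
    rw [hsp] at this
    exact fun x hx => this (Submodule.subset_span hx)
  let z (M : Type u) [Field M] [Algebra M L] : b → Algebra.adjoin M b :=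
    fun i => ⟨i, Algebra.subset_adjoin i.2⟩
  have htop : ∀ (M : Type u) [Field M] [Algebra M L],
      Algebra.adjoin M (Set.range (z M)) = ⊤ := by
    intro M _ _
    convert Algebra.adjoin_adjoin_coe_preimage (R := M) (s := b) using 2
    ext x
    constructor
    · rintro ⟨i, rfl⟩
      exact i.2
    · intro hx
      exact ⟨⟨x, hx⟩, rfl⟩
  have halg : ∀ (M : Type u) [Field M] [Algebra M L],
      Algebra.IsAlgebraic (Algebra.adjoin M (Set.range (z M))) (Algebra.adjoin M b) := by
    intro M _ _
    rw [htop M]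
    exact ⟨fun x => isAlgebraic_algebraMap (R := (⊤ : Subalgebra M (Algebra.adjoin M b)))
      (⟨x, trivial⟩ : (⊤ : Subalgebra M (Algebra.adjoin M b)))⟩
  have hle : ∀ (M : Type u) [Field M] [Algebra M L],
      Algebra.trdeg M (Algebra.adjoin M b) ≤ Fintype.card b := by
    intro M _ _
    have := halg M
    refine (Algebra.IsAlgebraic.trdeg_le_cardinalMk M (Set.range (z M))).trans ?_
    rw [← Cardinal.mk_fintype]
    exact Cardinal.mk_range_le
  rw [← key K'] at h2
  rw [← key K]
  have hcard' : Fintype.card b = m := by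
    apply le_antisymm hcard
    exact_mod_cast h2.trans (hle K')
  have := halg K'
  -- A generating set with no more elements than the transcendence degree is a transcendence basis;
  -- its independence over `K'` then descends to `K`.
  have hind := (Algebra.IsAlgebraic.isTranscendenceBasis_of_le_trdeg_of_finite K' (z K')
    (by rw [Cardinal.mk_fintype, hcard']; exact h2)).1
  have hindL : AlgebraicIndependent K' (fun i : b => (i : L)) :=
    hind.map' (f := (Algebra.adjoin K' b).val) Subtype.val_injective
  have hindK := (hindL.restrictScalars (R := K) (algebraMap K K').injective)
  have hz : AlgebraicIndependent K (z K) :=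
    AlgebraicIndependent.of_comp (Algebra.adjoin K b).val hindK
  apply le_antisymm
  · rw [← hcard']; exact hle K
  · rw [← hcard', ← Cardinal.mk_fintype]
    exact hz.cardinalMk_le_trdeg

theorem trdeg_add_eq_of_field (k K M : Type u) [Field k] [Field K] [Field M] [Algebra k K]
    [Algebra K M] [Algebra k M] [IsScalarTower k K M] :
    Algebra.trdeg k K + Algebra.trdeg K M = Algebra.trdeg k M :=
  trdeg_add_eq k K (A := M)

/-- Additivity in the tower `k ⊆ k(s) ⊆ k(s)(y)`. The field `K'` is an auxiliary extension of `k(s)`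
over which the lower bound is easier to verify. -/
theorem trdeg_adjoin_union {k L : Type u} [Field k] [Field L] [Algebra k L] {ι : Type*} [Finite ι]
    (s : Set L) (y : ι → L) (m : ℕ) (K' : IntermediateField k L)
    (hK : IntermediateField.adjoin k s ≤ K')
    (h1 : Module.finrank (IntermediateField.adjoin k s)
      (Submodule.span (IntermediateField.adjoin k s) (Set.range y)) ≤ m)
    (h2 : (m : Cardinal) ≤ Algebra.trdeg K' (Algebra.adjoin K' (Set.range y))) :
    Algebra.trdeg k (Algebra.adjoin k (s ∪ Set.range y)) =
      Algebra.trdeg k (Algebra.adjoin k s) + m := by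
  let _ : Algebra (IntermediateField.adjoin k s) K' :=
    (IntermediateField.inclusion hK).toRingHom.toAlgebra
  have : IsScalarTower (IntermediateField.adjoin k s) K' L :=
    IsScalarTower.of_algebraMap_eq fun x => rfl
  rw [trdeg_algebraAdjoin, trdeg_algebraAdjoin, ← IntermediateField.adjoin_adjoin_left,
    ← trdeg_adjoin_eq_of_finrank_span_le (K := IntermediateField.adjoin k s) y m h1 h2,
    trdeg_algebraAdjoin]
  exact (trdeg_add_eq_of_field k (IntermediateField.adjoin k s)
    (IntermediateField.adjoin (IntermediateField.adjoin k s) (Set.range y))).symm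

/-! ### Generic points -/

/-- A family `x` in `F` is a generic point of `S`: every point of `S` is a specialization of `x`,
and the specializations of `x` to points of `S` separate the elements of `F`. -/
structure IsGenericPoint {k E F τ : Type*} [Field k] [AddCommGroup E] [Module k E]
    [CommRing F] [Algebra k F] (S : Set E) (φ : τ → Module.Dual k E) (x : τ → F) : Prop where
  exists_eval : ∀ s ∈ S, ∃ ev : F →ₐ[k] k, ∀ j, φ j s = ev (x j)
  eq_zero : ∀ z : F, (∀ ev : F →ₐ[k] k, (∃ s ∈ S, ∀ j, φ j s = ev (x j)) → ev z = 0) → z = 0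

theorem coordinateRing_eq_adjoin {k E τ : Type*} [Field k] [AddCommGroup E] [Module k E]
    (S : Set E) (φ : τ → Module.Dual k E) (hφ : Submodule.span k (Set.range φ) = ⊤) :
    coordinateRing k S = Algebra.adjoin k (Set.range fun j => fun s : S => φ j s) := by
  apply le_antisymm
  · rw [coordinateRing, Algebra.adjoin_le_iff]
    rintro _ ⟨f, rfl⟩
    let r : Module.Dual k E →ₗ[k] (S → k) :=
      { toFun := fun f s => f s
        map_add' := fun _ _ => rfl
        map_smul' := fun _ _ => rfl }
    have : Submodule.span k (Set.range φ) ≤ Submodule.comap r (Subalgebra.toSubmodule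
        (Algebra.adjoin k (Set.range fun j => fun s : S => φ j s))) := by
      rw [Submodule.span_le]
      rintro _ ⟨j, rfl⟩
      exact Algebra.subset_adjoin ⟨j, rfl⟩
    rw [hφ] at this
    exact this (Submodule.mem_top (x := f))
  · apply Algebra.adjoin_mono
    rintro _ ⟨j, rfl⟩
    exact ⟨φ j, rfl⟩

/-- Both algebras are quotients of the polynomial ring on `τ`. A polynomial vanishes on `S` exactly
when it vanishes at `x`: `eq_zero` gives one direction and `exists_eval` the other. -/
theorem IsGenericPoint.nonempty_algEquiv {k E F τ : Type*} [Field k] [AddCommGroup E] [Module k E]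
    [CommRing F] [Algebra k F] {S : Set E} {φ : τ → Module.Dual k E} {x : τ → F}
    (h : IsGenericPoint S φ x) (hφ : Submodule.span k (Set.range φ) = ⊤) :
    Nonempty (coordinateRing k S ≃ₐ[k] Algebra.adjoin k (Set.range x)) := by
  rw [coordinateRing_eq_adjoin S φ hφ, Algebra.adjoin_range_eq_range_aeval,
    Algebra.adjoin_range_eq_range_aeval]
  have hev : ∀ (ev : F →ₐ[k] k) (P : MvPolynomial τ k),
      ev (MvPolynomial.aeval x P) = MvPolynomial.aeval (fun j => ev (x j)) P := by
    intro ev P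
    exact (MvPolynomial.comp_aeval_apply x ev P)
  have hS : ∀ (s : S) (P : MvPolynomial τ k),
      MvPolynomial.aeval (fun j => fun s : S => φ j s) P s =
        MvPolynomial.aeval (fun j => φ j (s : E)) P := by
    intro s P
    exact (MvPolynomial.comp_aeval_apply (fun j => fun s : S => φ j s)
      (Pi.evalAlgHom k (fun _ : S => k) s) P)
  have hker : RingHom.ker (MvPolynomial.aeval (R := k) fun j => fun s : S => φ j s) =
      RingHom.ker (MvPolynomial.aeval (R := k) x) := by
    ext P
    rw [RingHom.mem_ker, RingHom.mem_ker]
    constructor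
    · intro hP
      apply h.eq_zero
      rintro ev ⟨s, hs, hsx⟩
      have := congrFun hP ⟨s, hs⟩
      rw [hS] at this
      rw [hev, ← funext hsx]
      exact this
    · intro hP
      funext s
      obtain ⟨ev, hsx⟩ := h.exists_eval s s.2
      rw [hS, funext hsx, ← hev, hP, map_zero]
      rfl
  exact ⟨((Ideal.quotientKerEquivRange _).symm.trans (Ideal.quotientEquivAlgOfEq k hker)).trans
    (Ideal.quotientKerEquivRange _)⟩

theorem IsGenericPoint.dimension_eq {k E F τ : Type*} [Field k] [AddCommGroup E] [Module k E]
    [CommRing F] [Algebra k F] {S : Set E} {φ : τ → Module.Dual k E} {x : τ → F}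
    (h : IsGenericPoint S φ x) (hφ : Submodule.span k (Set.range φ) = ⊤) :
    dimension k S = ringKrullDim (Algebra.adjoin k (Set.range x)) := by
  obtain ⟨e⟩ := h.nonempty_algEquiv hφ
  exact ringKrullDim_eq_of_ringEquiv e.toRingEquiv

theorem nonempty_algEquiv_adjoin_map {k F L τ : Type*} [Field k] [CommRing F] [Algebra k F]
    [CommRing L] [Algebra k L] (f : F →ₐ[k] L) (hf : Function.Injective f) (x : τ → F) :
    Nonempty (Algebra.adjoin k (Set.range x) ≃ₐ[k] Algebra.adjoin k (Set.range (f ∘ x))) := by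
  rw [Set.range_comp, ← AlgHom.map_adjoin]
  exact ⟨Subalgebra.equivMapOfInjective _ f hf⟩

/-- Evaluation of elements of `k[σ]_d` at a point where `d` does not vanish. -/
theorem exists_eval_localizationAway {k σ : Type*} [Field k]
    (d : MvPolynomial σ k) (p : σ → k) (hp : MvPolynomial.eval p d ≠ 0) :
    ∃ ev : Localization.Away d →ₐ[k] k,
      ∀ r, ev (algebraMap (MvPolynomial σ k) _ r) = MvPolynomial.eval p r := by
  have hu : ∀ y : Submonoid.powers d,
      IsUnit (MvPolynomial.aeval (R := k) p (y : MvPolynomial σ k)) := by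
    rintro ⟨_, m, rfl⟩
    simp only [map_pow]
    exact (isUnit_iff_ne_zero.2 hp).pow m
  exact ⟨IsLocalization.liftAlgHom hu, fun r => IsLocalization.lift_eq _ r⟩

/-- Points with coordinates in the localization `k[σ]_d` are determined by their values at the
`p` in any nonempty principal open subset. -/
theorem localizationAway_eq_zero {k σ : Type*} [Field k] [Infinite k] [Finite σ]
    (d h : MvPolynomial σ k) (hd : d ≠ 0) (hh : h ≠ 0) (z : Localization.Away d)
    (hz : ∀ ev : Localization.Away d →ₐ[k] k,
      ev (algebraMap (MvPolynomial σ k) _ h) ≠ 0 → ev z = 0) : z = 0 := by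
  obtain ⟨N, a, ha⟩ := IsLocalization.Away.surj d z
  have ha0 : a = 0 := by
    -- The numerator vanishes wherever `d` and `h` do not, so this product vanishes everywhere and
    -- is the zero polynomial over the infinite field.
    have : a * (d * h) = 0 := by
      apply MvPolynomial.funext
      intro p
      rw [map_mul, map_mul, map_zero]
      by_cases hp : MvPolynomial.eval p d = 0
      · rw [hp, zero_mul, mul_zero]
      by_cases hp' : MvPolynomial.eval p h = 0
      · rw [hp', mul_zero, mul_zero]
      obtain ⟨ev, hev⟩ := exists_eval_localizationAway d p hp
      have h1 := hz ev (by rwa [hev])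
      have h2 := congrArg ev ha
      rw [map_mul, h1, zero_mul, hev] at h2
      rw [← h2, zero_mul]
    exact (mul_eq_zero.1 this).resolve_right (mul_ne_zero hd hh)
  rw [ha0, map_zero, ← map_pow] at ha
  have hu : IsUnit (algebraMap (MvPolynomial σ k) (Localization.Away d) (d ^ N)) :=
    IsLocalization.map_units (M := Submonoid.powers d) _ ⟨d ^ N, N, rfl⟩
  exact (hu.mul_left_eq_zero).1 ha

/-! ### Combinatorics of enhanced partitions -/

section Combinatorics

variable {n : ℕ} (lam : n.Partition)

theorem row_antitone : Antitone (row lam) := by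
  intro i j h
  have hs : (rows lam).Pairwise (· ≥ ·) := Multiset.pairwise_sort _ _
  rcases h.eq_or_lt with rfl | h
  · exact le_rfl
  · exact List.pairwise_iff_get.1 hs i j h

theorem parts_eq_map_row : lam.parts = Finset.univ.val.map (row lam) := by
  have h : ((rows lam : List ℕ) : Multiset ℕ) = lam.parts := Multiset.sort_eq _ _
  rw [Fin.univ_val_map, ← h]
  congr 1
  exact (List.ofFn_get (rows lam)).symm

theorem card_filter_row (p : ℕ → Prop) [DecidablePred p] :
    (Finset.univ.filter fun i => p (row lam i)).card = lam.parts.countP p := by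
  rw [parts_eq_map_row, Multiset.countP_map]
  rfl

theorem sum_map_count (P : Multiset ℕ) (l : List ℕ) (hl : l.Nodup) :
    (l.map fun b => P.count b).sum = P.countP (· ∈ l) := by
  rw [← List.sum_toFinset _ hl, Multiset.countP_eq_card_filter,
    ← Multiset.sum_count_eq_card (s := l.toFinset)]
  · refine Finset.sum_congr rfl fun a ha => ?_
    rw [Multiset.count_filter_of_pos (List.mem_toFinset.1 ha)]
  · intro a ha
    exact List.mem_toFinset.2 (Multiset.mem_filter.1 ha).2

theorem mem_distinctRows {b : ℕ} : b ∈ distinctRows lam ↔ b ∈ lam.parts := by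
  rw [distinctRows, Multiset.mem_sort, Multiset.mem_dedup]

theorem distinctRows_pairwise : (distinctRows lam).Pairwise (· > ·) := by
  have h1 : (distinctRows lam).Pairwise (· ≥ ·) := Multiset.pairwise_sort _ _
  have h2 : (distinctRows lam).Nodup := by
    rw [← Multiset.coe_nodup, distinctRows, Multiset.sort_eq]
    exact Multiset.nodup_dedup _
  exact (h1.and h2).imp fun h => lt_of_le_of_ne h.1 (Ne.symm h.2)

theorem sum_take_multiplicities (j : ℕ) : ((multiplicities lam).take j).sum =
    lam.parts.countP (· ∈ (distinctRows lam).take j) := by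
  rw [multiplicities, ← List.map_take, sum_map_count]
  exact ((distinctRows_pairwise lam).imp fun h => (ne_of_gt h)).sublist (List.take_sublist _ _)

/-- The length of row number `q` (counted from zero), or `0` if there is no such row. -/
def rowOrZero (q : ℕ) : ℕ := if h : q < numRows lam then row lam ⟨q, h⟩ else 0

/-- Rows decrease, so the rows longer than `b` are the first `q`. Row number `q` is then the longest
remaining one, and `b` occurs among these. -/
theorem rowOrZero_eq_of_card {q b : ℕ} (hb : b ∈ lam.parts)
    (h : (Finset.univ.filter fun i => b < row lam i).card = q) :
    rowOrZero lam q = b := by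
  have hlow : Finset.univ.filter (fun i => b < row lam i) =
      Finset.univ.filter (fun i : Fin (numRows lam) => (i : ℕ) < q) := by
    have hsub : ∀ i : Fin (numRows lam), b < row lam i → (i : ℕ) < q := by
      intro i hi
      have : Finset.Iic i ⊆ Finset.univ.filter (fun i => b < row lam i) := by
        intro j hj
        exact Finset.mem_filter.2 ⟨Finset.mem_univ _,
          hi.trans_le (row_antitone lam (Finset.mem_Iic.1 hj))⟩
      have := Finset.card_le_card this
      rw [h, Fin.card_Iic] at this
      omega
    apply Finset.eq_of_subset_of_card_le
    · intro i hi
      exact Finset.mem_filter.2 ⟨Finset.mem_univ _, hsub i (Finset.mem_filter.1 hi).2⟩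
    · rw [h, Fin.card_filter_val_lt]
      exact min_le_right _ _
  have hiff : ∀ i : Fin (numRows lam), b < row lam i ↔ (i : ℕ) < q := by
    intro i
    have := Finset.ext_iff.1 hlow i
    simpa using this
  rw [parts_eq_map_row, Multiset.mem_map] at hb
  obtain ⟨i, -, hi⟩ := hb
  have hqi : q ≤ i := by
    have := hiff i
    omega
  have hq : q < numRows lam := hqi.trans_lt i.2
  rw [rowOrZero, dif_pos hq]
  apply le_antisymm
  · have := hiff ⟨q, hq⟩
    simpa using this
  · rw [← hi]
    exact row_antitone lam hqi

/-- For an enhanced partition `lam[q]`, exactly `q` rows are longer than row number `q`. -/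
theorem card_row_gt {q : ℕ} (hq : IsEnhancedPartition lam q) :
    (Finset.univ.filter fun i => rowOrZero lam q < row lam i).card = q := by
  obtain ⟨j, hj, rfl⟩ := hq
  rw [sum_take_multiplicities]
  rcases hj.lt_or_eq with hj | rfl
  · rw [multiplicities, List.length_map] at hj
    have hmem : (distinctRows lam)[j] ∈ lam.parts :=
      (mem_distinctRows lam).1 (List.getElem_mem hj)
    -- The distinct parts strictly decrease, so the first `j` of them are those exceeding the entry
    -- at index `j`.
    have hcount : lam.parts.countP (· ∈ (distinctRows lam).take j) =
        lam.parts.countP ((distinctRows lam)[j] < ·) := by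
      apply Multiset.countP_congr rfl
      intro x hx
      have hx' := (mem_distinctRows lam).2 hx
      have hp := List.pairwise_iff_getElem.1 (distinctRows_pairwise lam)
      simp only [eq_iff_iff]
      constructor
      · intro h
        obtain ⟨i, hi, rfl⟩ := List.mem_take_iff_getElem.1 h
        exact hp i j (by omega) hj (by omega)
      · intro h
        obtain ⟨i, hi, rfl⟩ := List.getElem_of_mem hx'
        apply List.mem_take_iff_getElem.2
        refine ⟨i, ?_, rfl⟩
        rw [lt_min_iff]
        refine ⟨?_, hi⟩
        by_contra hij
        rcases (not_lt.1 hij).eq_or_lt with h' | h'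
        · subst h'
          exact lt_irrefl _ h
        · exact lt_asymm h (hp j i hj hi h')
    rw [hcount, ← card_filter_row, rowOrZero_eq_of_card lam hmem rfl]
  -- Here `q = t`: the threshold is `0`, and every row exceeds it.
  · have h : lam.parts.countP (· ∈ (distinctRows lam).take (multiplicities lam).length) =
        numRows lam := by
      rw [multiplicities, List.length_map, List.take_length,
        Multiset.countP_eq_card.2 fun a ha => (mem_distinctRows lam).2 ha, parts_eq_map_row,
        Multiset.card_map]
      simp
    rw [h, rowOrZero, dif_neg (lt_irrefl _), Finset.filter_true_of_mem fun i _ => row_pos lam i]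
    simp

theorem row_lastEqualRow (q : Fin (numRows lam)) : row lam (lastEqualRow lam q) = row lam q := by
  have hsub : Finset.Iic q ⊆ Finset.univ.filter (fun i => row lam q ≤ row lam i) := by
    intro j hj
    exact Finset.mem_filter.2 ⟨Finset.mem_univ _, row_antitone lam (Finset.mem_Iic.1 hj)⟩
  have hc := Finset.card_le_card hsub
  rw [Fin.card_Iic] at hc
  apply le_antisymm
  · apply row_antitone
    rw [Fin.le_def]
    change _ ≤ _ - 1
    omega
  -- If the chosen row were shorter, all rows counted in its index would precede it, but one fewer
  -- precede it than are counted.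
  · by_contra hlt
    have : Finset.univ.filter (fun i => row lam q ≤ row lam i) ⊆
        Finset.Iio (lastEqualRow lam q) := by
      intro i hi
      rw [Finset.mem_Iio]
      by_contra h
      exact hlt ((Finset.mem_filter.1 hi).2.trans (row_antitone lam (not_lt.1 h)))
    have := Finset.card_le_card this
    rw [Fin.card_Iio] at this
    change _ ≤ _ - 1 at this
    omega

end Combinatorics

/-! ### Coordinates along the Jordan strings -/

section Coordinates

variable {n : ℕ} (lam : n.Partition) {R : Type*} [Field R]

/-- The coordinate of a vector at position `r` of row `i`, extended by zero. -/
def coord (x : Fin n → R) (i : Fin (numRows lam)) (r : ℕ) : R :=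
  if h : r < row lam i then x (boxEquiv lam ⟨i, r, h⟩) else 0

/-- The vector with prescribed coordinates. -/
def ofCoord (f : Fin (numRows lam) → ℕ → R) : Fin n → R :=
  fun b => f ((boxEquiv lam).symm b).1 ((boxEquiv lam).symm b).2

theorem coord_box (x : Fin n → R) (c : Σ i : Fin (numRows lam), Fin (row lam i)) :
    coord lam x c.1 c.2 = x (boxEquiv lam c) :=
  dif_pos c.2.2

theorem coord_of_le (x : Fin n → R) {i : Fin (numRows lam)} {r : ℕ} (h : row lam i ≤ r) :
    coord lam x i r = 0 :=
  dif_neg (not_lt.2 h)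

theorem coord_ext {x y : Fin n → R} (h : ∀ i r, coord lam x i r = coord lam y i r) : x = y := by
  funext b
  obtain ⟨c, rfl⟩ := (boxEquiv lam).surjective b
  rw [← coord_box lam x, ← coord_box lam y, h]

theorem matrix_coord_ext {A B : Matrix (Fin n) (Fin n) R}
    (h : ∀ x i r, coord lam (A *ᵥ x) i r = coord lam (B *ᵥ x) i r) : A = B := by
  apply Matrix.toLin'.injective
  refine LinearMap.ext fun x => ?_
  rw [Matrix.toLin'_apply, Matrix.toLin'_apply]
  exact coord_ext lam (h x)

theorem coord_ofCoord (f : Fin (numRows lam) → ℕ → R) (i : Fin (numRows lam)) (r : ℕ) :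
    coord lam (ofCoord lam f) i r = if r < row lam i then f i r else 0 := by
  unfold coord ofCoord
  split_ifs with h
  · rw [Equiv.symm_apply_apply]
  · rfl

theorem coord_add (x y : Fin n → R) (i : Fin (numRows lam)) (r : ℕ) :
    coord lam (x + y) i r = coord lam x i r + coord lam y i r := by
  unfold coord
  split_ifs <;> simp

theorem coord_sub (x y : Fin n → R) (i : Fin (numRows lam)) (r : ℕ) :
    coord lam (x - y) i r = coord lam x i r - coord lam y i r := by
  unfold coord
  split_ifs <;> simp

theorem coord_smul (a : R) (x : Fin n → R) (i : Fin (numRows lam)) (r : ℕ) :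
    coord lam (a • x) i r = a * coord lam x i r := by
  unfold coord
  split_ifs <;> simp

theorem jordanMatrix_apply (c d : Σ i : Fin (numRows lam), Fin (row lam i)) :
    jordanMatrix R lam (boxEquiv lam c) (boxEquiv lam d) =
      if c.1 = d.1 ∧ (d.2 : ℕ) = c.2 + 1 then 1 else 0 := by
  obtain ⟨i, r⟩ := c
  obtain ⟨j, s⟩ := d
  rw [jordanMatrix, Matrix.reindex_apply, Matrix.submatrix_apply, Equiv.symm_apply_apply,
    Equiv.symm_apply_apply]
  by_cases h : i = j
  · subst h
    rw [Matrix.blockDiagonal'_apply_eq]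
    simp [jordanBlock]
  · rw [Matrix.blockDiagonal'_apply_ne _ _ _ h]
    simp [h]

/-- `J` shifts each row by one position; the extension of `coord` by zero makes the formula valid at
row ends and beyond. -/
theorem coord_jordanMatrix_mulVec (x : Fin n → R) (i : Fin (numRows lam)) (r : ℕ) :
    coord lam (jordanMatrix R lam *ᵥ x) i r = coord lam x i (r + 1) := by
  by_cases h : r < row lam i
  · rw [coord, dif_pos h, Matrix.mulVec, dotProduct, ← (boxEquiv lam).sum_comp]
    simp only [jordanMatrix_apply]
    by_cases h' : r + 1 < row lam i
    · rw [Finset.sum_eq_single ⟨i, r + 1, h'⟩]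
      · rw [coord, dif_pos h']
        simp
      · rintro ⟨j, s⟩ - hne
        rw [if_neg, zero_mul]
        rintro ⟨h1, h2⟩
        simp only at h1 h2
        subst h1
        exact hne (by rw [Sigma.mk.injEq]; exact ⟨rfl, heq_of_eq (Fin.ext h2)⟩)
      · simp
    · rw [coord, dif_neg h']
      apply Finset.sum_eq_zero
      rintro ⟨j, s⟩ -
      rw [if_neg, zero_mul]
      rintro ⟨h1, h2⟩
      simp only at h1 h2
      subst h1
      omega
  · rw [coord_of_le lam _ (not_lt.1 h), coord_of_le lam _ (by omega)]

theorem coord_jordanMatrix_pow_mulVec (b : ℕ) (x : Fin n → R) (i : Fin (numRows lam)) (r : ℕ) :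
    coord lam ((jordanMatrix R lam ^ b) *ᵥ x) i r = coord lam x i (r + b) := by
  induction b generalizing r with
  | zero => simp
  | succ b ih =>
    rw [pow_succ', ← Matrix.mulVec_mulVec, coord_jordanMatrix_mulVec, ih]
    congr 1
    omega

theorem jordanMatrix_map {S : Type*} [Field S] (f : R →+* S) :
    (jordanMatrix R lam).map f = jordanMatrix S lam := by
  ext a b
  obtain ⟨c, rfl⟩ := (boxEquiv lam).surjective a
  obtain ⟨d, rfl⟩ := (boxEquiv lam).surjective b
  rw [Matrix.map_apply, jordanMatrix_apply, jordanMatrix_apply]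
  split_ifs <;> simp

theorem coord_stringGenerator (i j : Fin (numRows lam)) (r : ℕ) :
    coord lam (stringGenerator R lam i) j r = if j = i ∧ r + 1 = row lam i then 1 else 0 := by
  have hpos := row_pos lam i
  by_cases h : r < row lam j
  · rw [coord, dif_pos h, stringGenerator, Pi.single_apply]
    congr 1
    rw [(boxEquiv lam).apply_eq_iff_eq, Sigma.mk.injEq, eq_iff_iff]
    constructor
    · rintro ⟨rfl, h2⟩
      have := congrArg Fin.val (eq_of_heq h2)
      simp only at this
      exact ⟨rfl, by omega⟩
    · rintro ⟨rfl, h2⟩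
      exact ⟨rfl, heq_of_eq (Fin.ext (by simp only; omega))⟩
  · rw [coord_of_le lam _ (not_lt.1 h), if_neg]
    rintro ⟨rfl, h2⟩
    omega

/-- The rank of the powers of `J_lam`. -/
theorem rank_jordanMatrix_pow (b : ℕ) :
    (jordanMatrix R lam ^ b).rank = ∑ i, (row lam i - b) := by
  classical
  -- `D` is the coordinate projection onto the image of `J ^ b`, and `T` shifts by `b` the other
  -- way. The identities `D = J ^ b T` and `J ^ b = D J ^ b` force equal ranks.
  let D : Matrix (Fin n) (Fin n) R := Matrix.diagonal fun a =>
    if (((boxEquiv lam).symm a).2 : ℕ) + b < row lam ((boxEquiv lam).symm a).1 then 1 else 0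
  have hD : ∀ x i r, coord lam (D *ᵥ x) i r = if r + b < row lam i then coord lam x i r else 0 := by
    intro x i r
    unfold coord
    by_cases h : r < row lam i
    · rw [dif_pos h, dif_pos h, Matrix.mulVec_diagonal, Equiv.symm_apply_apply, ite_mul, one_mul,
        zero_mul]
    · rw [dif_neg h, dif_neg h, ite_self]
  let T : (Fin n → R) →ₗ[R] (Fin n → R) :=
    { toFun := fun x => ofCoord lam fun i r => if b ≤ r then coord lam x i (r - b) else 0
      map_add' := fun x y => by
        funext c
        simp only [ofCoord, coord_add, Pi.add_apply]
        split_ifs <;> simp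
      map_smul' := fun a x => by
        funext c
        simp only [ofCoord, coord_smul, Pi.smul_apply, RingHom.id_apply, smul_eq_mul]
        split_ifs <;> simp }
  have hT : ∀ x, T x = ofCoord lam fun i r => if b ≤ r then coord lam x i (r - b) else 0 :=
    fun _ => rfl
  have h1 : D = jordanMatrix R lam ^ b * LinearMap.toMatrix' T := by
    refine matrix_coord_ext (R := R) lam fun x i r => ?_
    rw [hD, ← Matrix.mulVec_mulVec, LinearMap.toMatrix'_mulVec, coord_jordanMatrix_pow_mulVec]
    rw [hT, coord_ofCoord, if_pos (Nat.le_add_left _ _), Nat.add_sub_cancel]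
  have h2 : jordanMatrix R lam ^ b = D * jordanMatrix R lam ^ b := by
    refine matrix_coord_ext (R := R) lam fun x i r => ?_
    rw [← Matrix.mulVec_mulVec, hD, coord_jordanMatrix_pow_mulVec]
    split_ifs with h
    · rfl
    · exact coord_of_le lam _ (not_lt.1 h)
  have hr : (jordanMatrix R lam ^ b).rank = D.rank := by
    apply le_antisymm
    · conv_lhs => rw [h2]
      exact Matrix.rank_mul_le_left _ _
    · rw [h1]
      exact Matrix.rank_mul_le_left _ _
  rw [hr, Matrix.rank_diagonal, ← Fintype.card_congr ((boxEquiv lam).subtypeEquiv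
    (p := fun c => (c.2 : ℕ) + b < row lam c.1) fun c => by
    rw [Equiv.symm_apply_apply]
    simp), Fintype.card_subtype, Finset.card_filter, Fintype.sum_sigma]
  refine Finset.sum_congr rfl fun i _ => ?_
  rw [← Finset.card_filter]
  have : (Finset.univ.filter fun r : Fin (row lam i) => (r : ℕ) + b < row lam i) =
      Finset.univ.filter fun r : Fin (row lam i) => (r : ℕ) < row lam i - b := by
    ext r
    simp only [Finset.mem_filter, Finset.mem_univ, true_and]
    omega
  rw [this, Fin.card_filter_val_lt]
  omega

theorem rank_jordanMatrix_pow_eq_add (b : ℕ) : (jordanMatrix R lam ^ b).rank =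
    (jordanMatrix R lam ^ (b + 1)).rank +
      (Finset.univ.filter fun i => b < row lam i).card := by
  rw [rank_jordanMatrix_pow, rank_jordanMatrix_pow, Finset.card_filter, ← Finset.sum_add_distrib]
  refine Finset.sum_congr rfl fun i _ => ?_
  split_ifs <;> omega

/-- The boxes that are not at the end of a row longer than `b`: they span the space
`Im J + Ker J ^ b`. -/
def InSpan (b : ℕ) (a : Fin n) : Prop :=
  (((boxEquiv lam).symm a).2 : ℕ) + 1 < row lam ((boxEquiv lam).symm a).1 ∨
    row lam ((boxEquiv lam).symm a).1 ≤ b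

instance (b : ℕ) : DecidablePred (InSpan lam b) := fun _ => instDecidableOr

theorem not_inSpan_box {b : ℕ} {c : Σ i : Fin (numRows lam), Fin (row lam i)} :
    ¬ InSpan lam b (boxEquiv lam c) ↔ (c.2 : ℕ) + 1 = row lam c.1 ∧ b < row lam c.1 := by
  have := c.2.2
  rw [InSpan, Equiv.symm_apply_apply]
  omega

theorem card_inSpan (b : ℕ) : Fintype.card {a // InSpan lam b a} =
    n - (Finset.univ.filter fun i => b < row lam i).card := by
  have h1 : (Finset.univ.filter fun i => b < row lam i).card =
      Fintype.card {a // ¬ InSpan lam b a} := by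
    rw [Fintype.card_subtype]
    refine Finset.card_bij (fun i _ => boxEquiv lam
      ⟨i, ⟨row lam i - 1, Nat.sub_lt (row_pos lam i) one_pos⟩⟩) ?_ ?_ ?_
    · intro i hi
      have := row_pos lam i
      refine Finset.mem_filter.2 ⟨Finset.mem_univ _, (not_inSpan_box lam).2 ⟨?_, ?_⟩⟩
      · simp only
        omega
      · exact (Finset.mem_filter.1 hi).2
    · intro i _ j _ h
      exact congrArg Sigma.fst ((boxEquiv lam).injective h)
    · intro a ha
      obtain ⟨⟨i, r⟩, rfl⟩ := (boxEquiv lam).surjective a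
      obtain ⟨h, h'⟩ := (not_inSpan_box lam).1 (Finset.mem_filter.1 ha).2
      refine ⟨i, Finset.mem_filter.2 ⟨Finset.mem_univ _, h'⟩, ?_⟩
      congr 2
      exact Fin.ext (by simp only at h ⊢; omega)
  have h2 := Fintype.card_subtype_compl (InSpan lam b)
  have h3 := Fintype.card_subtype_le (InSpan lam b)
  rw [h1, h2]
  simp only [Fintype.card_fin] at *
  omega

theorem coord_eq_zero_of_not_inSpan {b : ℕ} {x : Fin n → R}
    (hx : ∀ a, ¬ InSpan lam b a → x a = 0) {i : Fin (numRows lam)} {r : ℕ}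
    (hr : r + 1 = row lam i) (hb : b < row lam i) : coord lam x i r = 0 := by
  rw [coord, dif_pos (by omega)]
  apply hx
  exact (not_inSpan_box lam).2 ⟨hr, hb⟩

/-- `J ^ b` maps `Im J + Ker J ^ b` into the image of `J ^ (b + 1)`; this inclusion is the source of
the linear relations. The witness shifts `x` back by one; its entry at position `0`, where `r - 1`
truncates, is never read. -/
theorem exists_pow_mulVec_eq {b : ℕ} {x : Fin n → R} (hx : ∀ a, ¬ InSpan lam b a → x a = 0) :
    ∃ z, (jordanMatrix R lam ^ b) *ᵥ x = (jordanMatrix R lam ^ (b + 1)) *ᵥ z := by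
  refine ⟨ofCoord lam fun i r => coord lam x i (r - 1), coord_ext lam fun i r => ?_⟩
  rw [coord_jordanMatrix_pow_mulVec, coord_jordanMatrix_pow_mulVec, coord_ofCoord]
  split_ifs with h
  · congr 1
  · by_cases h' : r + b + 1 = row lam i
    · exact coord_eq_zero_of_not_inSpan lam hx h' (by omega)
    · exact coord_of_le lam _ (by omega)

theorem exists_jordanMatrix_mulVec_eq {x : Fin n → R}
    (hx : ∀ i r, r + 1 = row lam i → coord lam x i r = 0) :
    ∃ z, jordanMatrix R lam *ᵥ z = x := by
  refine ⟨ofCoord lam fun i r => coord lam x i (r - 1), coord_ext lam fun i r => ?_⟩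
  rw [coord_jordanMatrix_mulVec, coord_ofCoord]
  split_ifs with h
  · congr 1
  · by_cases h' : r + 1 = row lam i
    · exact (hx i r h').symm
    · exact (coord_of_le lam _ (by omega)).symm

/-- An endomorphism which commutes with `J_lam` and moves the generator of the string `i` by the
given combination of generators of strings that are not longer. -/
theorem exists_commuting_endomorphism (i : Fin (numRows lam)) (γ : Fin (numRows lam) → R)
    (hγ : ∀ l, row lam i < row lam l → γ l = 0) :
    ∃ N : Matrix (Fin n) (Fin n) R, ∀ x l s,
      coord lam (N *ᵥ x) l s = γ l * coord lam x i (s + (row lam i - row lam l)) := by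
  -- The shift aligns the ends of the rows `i` and `l`. Where the subtraction truncates, row `l` is
  -- longer and `γ l = 0`.
  let T : (Fin n → R) →ₗ[R] (Fin n → R) :=
    { toFun := fun x => ofCoord lam fun l s => γ l * coord lam x i (s + (row lam i - row lam l))
      map_add' := fun x y => by
        funext c
        simp only [ofCoord, coord_add, Pi.add_apply, mul_add]
      map_smul' := fun a x => by
        funext c
        simp only [ofCoord, coord_smul, Pi.smul_apply, RingHom.id_apply, smul_eq_mul]
        ring }
  refine ⟨LinearMap.toMatrix' T, fun x l s => ?_⟩
  rw [LinearMap.toMatrix'_mulVec]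
  have hT : T x = ofCoord lam fun l s => γ l * coord lam x i (s + (row lam i - row lam l)) := rfl
  rw [hT, coord_ofCoord]
  split_ifs with h
  · rfl
  · by_cases h' : row lam i < row lam l
    · rw [hγ l h', zero_mul]
    · rw [coord_of_le lam x, mul_zero]
      omega

/-- A general vector of `Im J + Ker J ^ b` is conjugate, modulo `Im J`, to the generator of a
string of length `b` under the centralizer of `J`. -/
theorem exists_centralizer_mulVec_eq (i : Fin (numRows lam)) {w : Fin n → R}
    (hw : ∀ a, ¬ InSpan lam (row lam i) a → w a = 0)
    (hi : w (boxEquiv lam ⟨i, ⟨row lam i - 1, Nat.sub_lt (row_pos lam i) one_pos⟩⟩) ≠ 0) :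
    ∃ c : GL (Fin n) R, conj c (jordanMatrix R lam) = jordanMatrix R lam ∧
      ∃ z, (c : Matrix (Fin n) (Fin n) R) *ᵥ stringGenerator R lam i +
        jordanMatrix R lam *ᵥ z = w := by
  have hposi := row_pos lam i
  have hi' : coord lam w i (row lam i - 1) ≠ 0 := by
    rw [coord, dif_pos (by omega)]
    exact hi
  -- Chosen so that `(1 + N) v_i` and `w` agree at all row ends, hence modulo `Im J`.
  let γ : Fin (numRows lam) → R := fun l => coord lam w l (row lam l - 1) - if l = i then 1 else 0
  have hγ : ∀ l, row lam i < row lam l → γ l = 0 := by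
    intro l hl
    have : l ≠ i := by rintro rfl; exact lt_irrefl _ hl
    have hl0 := row_pos lam l
    simp only [γ, if_neg this, sub_zero]
    exact coord_eq_zero_of_not_inSpan lam hw (by omega) hl
  obtain ⟨N, hN⟩ := exists_commuting_endomorphism lam i γ hγ
  have hcomm : N * jordanMatrix R lam = jordanMatrix R lam * N := by
    refine matrix_coord_ext (R := R) lam fun x l s => ?_
    rw [← Matrix.mulVec_mulVec, ← Matrix.mulVec_mulVec, hN, coord_jordanMatrix_mulVec,
      coord_jordanMatrix_mulVec, hN]
    congr 2
    omega
  have hsq : N * N = γ i • N := by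
    refine matrix_coord_ext (R := R) lam fun x l s => ?_
    rw [← Matrix.mulVec_mulVec, Matrix.smul_mulVec, coord_smul, hN, hN, hN]
    simp
    ring
  set β := coord lam w i (row lam i - 1) with hβ
  have hγi : γ i = β - 1 := by simp [γ, hβ]
  -- Since `N² = (β - 1) N`, the inverse of `1 + N` is linear in `N`; it exists because `β ≠ 0`.
  have hmul : (1 + N) * (1 - β⁻¹ • N) = 1 := by
    have : (1 + N) * (1 - β⁻¹ • N) = 1 + N - β⁻¹ • N - β⁻¹ • (N * N) := by
      rw [add_mul, one_mul, mul_sub, mul_one, Matrix.mul_smul]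
      abel
    rw [this, hsq, hγi, smul_smul]
    have : β⁻¹ * (β - 1) = 1 - β⁻¹ := by field_simp
    rw [this, sub_smul, one_smul]
    abel
  let c : GL (Fin n) R := ⟨1 + N, 1 - β⁻¹ • N, hmul, mul_eq_one_comm.1 hmul⟩
  refine ⟨c, ?_, ?_⟩
  · have h1 : (c : Matrix (Fin n) (Fin n) R) * jordanMatrix R lam = jordanMatrix R lam * c := by
      change (1 + N) * _ = _ * (1 + N)
      rw [add_mul, mul_add, hcomm, one_mul, mul_one]
    rw [conj, h1, Matrix.mul_assoc, ← Units.val_mul, mul_inv_cancel, Units.val_one, Matrix.mul_one]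
  · obtain ⟨z, hz⟩ := exists_jordanMatrix_mulVec_eq lam (R := R)
      (x := w - (1 + N) *ᵥ stringGenerator R lam i) (by
        intro l r hr
        rw [coord_sub, Matrix.add_mulVec, Matrix.one_mulVec, coord_add, hN, coord_stringGenerator,
          coord_stringGenerator]
        have hr' : r = row lam l - 1 := by omega
        by_cases hl : row lam i < row lam l
        · have hne : l ≠ i := by rintro rfl; exact lt_irrefl _ hl
          rw [hγ l hl, if_neg (fun h => hne h.1), zero_mul, add_zero, sub_zero]
          exact coord_eq_zero_of_not_inSpan lam hw hr hl
        · rw [if_pos (show i = i ∧ r + (row lam i - row lam l) + 1 = row lam i from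
            ⟨rfl, by omega⟩), mul_one]
          simp only [γ, ← hr']
          by_cases hli : l = i
          · subst hli
            simp [hr]
          · simp [hli])
    refine ⟨z, ?_⟩
    rw [hz]
    exact add_sub_cancel _ _

end Coordinates

/-! ### Matrices over a subfield -/

/-- Transvections reduce to a diagonal matrix, whose rank counts nonzero entries; a field
homomorphism preserves this count and the invertibility of the transvections. -/
theorem rank_map_field {K L m : Type*} [Field K] [Field L] [Fintype m] [DecidableEq m]
    (f : K →+* L) (A : Matrix m m K) : (A.map f).rank = A.rank := by
  classical
  obtain ⟨l, l', D, rfl⟩ := Matrix.Pivot.exists_list_transvec_mul_diagonal_mul_list_transvec A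
  have hdet : ∀ l : List (Matrix.TransvectionStruct m K),
      IsUnit (l.map Matrix.TransvectionStruct.toMatrix).prod.det := by
    intro l
    rw [Matrix.TransvectionStruct.det_toMatrix_prod]
    exact isUnit_one
  have hdet' : ∀ l : List (Matrix.TransvectionStruct m K),
      IsUnit ((l.map Matrix.TransvectionStruct.toMatrix).prod.map f).det := by
    intro l
    have := (hdet l).map f
    rwa [RingHom.map_det] at this
  rw [Matrix.map_mul, Matrix.map_mul, Matrix.rank_mul_eq_left_of_isUnit_det _ _ (hdet' l'),
    Matrix.rank_mul_eq_right_of_isUnit_det _ _ (hdet' l),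
    Matrix.rank_mul_eq_left_of_isUnit_det _ _ (hdet l'),
    Matrix.rank_mul_eq_right_of_isUnit_det _ _ (hdet l), Matrix.diagonal_map (map_zero f),
    Matrix.rank_diagonal, Matrix.rank_diagonal]
  refine Fintype.card_congr (Equiv.subtypeEquivRight fun i => ?_)
  simp

theorem map_units_conj {R S m : Type*} [CommRing R] [CommRing S] [Fintype m] [DecidableEq m]
    (f : R →+* S) (g : GL m R) (X : Matrix m m R) :
    ((g : Matrix m m R) * X * ((g⁻¹ : GL m R) : Matrix m m R)).map f =
      (Matrix.GeneralLinearGroup.map f g : Matrix m m S) * X.map f *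
        (((Matrix.GeneralLinearGroup.map f g)⁻¹ : GL m S) : Matrix m m S) := by
  rw [Matrix.map_mul, Matrix.map_mul, ← map_inv]
  rfl

/-- The image of the left kernel of `B` under `A` loses at most the left kernel of `A`. With `A = X
^ b` and `B = X ^ (b + 1)` it counts relations. -/
theorem finrank_map_vecMul_ker {K m : Type*} [Field K] [Fintype m] [DecidableEq m]
    (A B : Matrix m m K) :
    A.rank ≤ B.rank + Module.finrank K
      ((LinearMap.ker B.vecMulLinear).map A.vecMulLinear) := by
  have hrank : ∀ C : Matrix m m K,
      C.rank + Module.finrank K (LinearMap.ker C.vecMulLinear) = Fintype.card m := by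
    intro C
    have h := LinearMap.finrank_range_add_finrank_ker C.vecMulLinear
    rw [Module.finrank_fintype_fun_eq_card] at h
    rw [← h, ← Matrix.rank_transpose, Matrix.rank]
    have : Cᵀ.mulVecLin = C.vecMulLinear := LinearMap.ext fun x => Matrix.mulVec_transpose C x
    rw [this]
  have hA := hrank A
  have hB := hrank B
  have h := LinearMap.finrank_range_add_finrank_ker
    (A.vecMulLinear.domRestrict (LinearMap.ker B.vecMulLinear))
  rw [LinearMap.range_domRestrict] at h
  have hker : Module.finrank K (LinearMap.ker
      (A.vecMulLinear.domRestrict (LinearMap.ker B.vecMulLinear))) ≤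
      Module.finrank K (LinearMap.ker A.vecMulLinear) := by
    rw [LinearMap.ker_domRestrict]
    let ι : Submodule.comap (LinearMap.ker B.vecMulLinear).subtype
        (LinearMap.ker A.vecMulLinear) →ₗ[K] LinearMap.ker A.vecMulLinear :=
      { toFun := fun x => ⟨x.1.1, x.2⟩
        map_add' := fun _ _ => rfl
        map_smul' := fun _ _ => rfl }
    exact LinearMap.finrank_le_finrank_of_injective (f := ι) fun x y hxy =>
      Subtype.ext (Subtype.ext (congrArg (fun v => v.1) hxy))
  omega

section Span

variable {n : ℕ} (lam : n.Partition)

/-- Over the field of definition of `X = g J g⁻¹`, a vector of `g (Im J + Ker J ^ b)` has many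
linear relations between its coordinates. -/
theorem finrank_span_mulVec_le {K L : Type*} [Field K] [Field L] [Algebra K L] (b : ℕ)
    (X : Matrix (Fin n) (Fin n) K) (g : GL (Fin n) L) (w : Fin n → L)
    (hX : X.map (algebraMap K L) = conj g (jordanMatrix L lam))
    (hw : ∀ a, ¬ InSpan lam b a → w a = 0) :
    Module.finrank K (Submodule.span K
      (Set.range ((g : Matrix (Fin n) (Fin n) L) *ᵥ w))) ≤
        n - (Finset.univ.filter fun i => b < row lam i).card := by
  set y := (g : Matrix (Fin n) (Fin n) L) *ᵥ w with hy
  have hpow : ∀ c : ℕ, (X ^ c).map (algebraMap K L) * (g : Matrix (Fin n) (Fin n) L) =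
      (g : Matrix (Fin n) (Fin n) L) * jordanMatrix L lam ^ c := by
    intro c
    induction c with
    | zero => simp [Matrix.map_one]
    | succ c ih =>
      rw [pow_succ', Matrix.map_mul, Matrix.mul_assoc, ih, ← Matrix.mul_assoc, hX, conj_mul_coe,
        Matrix.mul_assoc, ← pow_succ']
  have hrank : ∀ c : ℕ, (X ^ c).rank = (jordanMatrix L lam ^ c).rank := by
    intro c
    have hg : IsUnit (g : Matrix (Fin n) (Fin n) L).det :=
      (Matrix.isUnit_iff_isUnit_det _).1 g.isUnit
    rw [← rank_map_field (algebraMap K L),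
      ← Matrix.rank_mul_eq_left_of_isUnit_det (g : Matrix (Fin n) (Fin n) L) _ hg, hpow,
      Matrix.rank_mul_eq_right_of_isUnit_det _ _ hg]
  have hU := finrank_map_vecMul_ker (X ^ b) (X ^ (b + 1))
  rw [hrank, hrank, rank_jordanMatrix_pow_eq_add] at hU
  obtain ⟨z, hz⟩ := exists_pow_mulVec_eq lam hw
  let φ := Fintype.linearCombination K y
  -- If `m X ^ (b + 1) = 0`, then `m X ^ b y = m g J ^ b w = m g J ^ (b + 1) z = m X ^ (b + 1) g z =
  -- 0`.
  have hle : (LinearMap.ker (X ^ (b + 1)).vecMulLinear).map (X ^ b).vecMulLinear ≤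
      LinearMap.ker φ := by
    rintro _ ⟨m, hm, rfl⟩
    have hm' : m ᵥ* (X ^ (b + 1)) = 0 := hm
    rw [LinearMap.mem_ker]
    change Fintype.linearCombination K y (m ᵥ* (X ^ b)) = 0
    have hmap : ∀ c : ℕ, (fun i => algebraMap K L ((m ᵥ* (X ^ c)) i)) =
        (fun i => algebraMap K L (m i)) ᵥ* (X ^ c).map (algebraMap K L) := by
      intro c
      funext i
      exact RingHom.map_vecMul (algebraMap K L) (X ^ c) m i
    have h1 : Fintype.linearCombination K y (m ᵥ* (X ^ b)) =
        (fun i => algebraMap K L ((m ᵥ* (X ^ b)) i)) ⬝ᵥ y := by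
      simp [Fintype.linearCombination_apply, dotProduct, Algebra.smul_def]
    rw [h1, hmap, ← Matrix.dotProduct_mulVec, hy, Matrix.mulVec_mulVec, hpow,
      ← Matrix.mulVec_mulVec, hz, Matrix.mulVec_mulVec, ← hpow, ← Matrix.mulVec_mulVec,
      Matrix.dotProduct_mulVec, ← hmap, hm']
    simp [dotProduct]
  have hdim := LinearMap.finrank_range_add_finrank_ker φ
  rw [Fintype.range_linearCombination, Module.finrank_fintype_fun_eq_card, Fintype.card_fin] at hdim
  have := Submodule.finrank_mono hle
  omega

open scoped IntermediateField.algebraAdjoinAdjoin in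
/-- The generic vector of `g (Im J + Ker J ^ b)` has the expected transcendence degree over the
field of definition of `g J g⁻¹`, if `g` is generic. -/
theorem trdeg_adjoin_conj_union {k L : Type u} [Field k] [Field L] [Algebra k L] (b : ℕ)
    (g : GL (Fin n) L) (w : Fin n → L) (hw : ∀ a, ¬ InSpan lam b a → w a = 0)
    (hind : AlgebraicIndependent k (Sum.elim (fun a : {a // InSpan lam b a} => w a)
      fun p : Fin n × Fin n => (g : Matrix (Fin n) (Fin n) L) p.1 p.2)) :
    Algebra.trdeg k (Algebra.adjoin k
      ((Set.range fun p : Fin n × Fin n => conj g (jordanMatrix L lam) p.1 p.2) ∪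
        Set.range ((g : Matrix (Fin n) (Fin n) L) *ᵥ w))) =
      Algebra.trdeg k (Algebra.adjoin k
        (Set.range fun p : Fin n × Fin n => conj g (jordanMatrix L lam) p.1 p.2)) +
        (n - (Finset.univ.filter fun i => b < row lam i).card : ℕ) := by
  set s := Set.range fun p : Fin n × Fin n => conj g (jordanMatrix L lam) p.1 p.2 with hs
  set t := Set.range fun p : Fin n × Fin n => (g : Matrix (Fin n) (Fin n) L) p.1 p.2 with ht
  -- `K' = k(g)` contains the entries of `g⁻¹`, hence those of `g J g⁻¹`, and `w` remains
  -- independent over it.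
  let K' := IntermediateField.adjoin k t
  let gK : Matrix (Fin n) (Fin n) K' := Matrix.of fun i j =>
    ⟨(g : Matrix (Fin n) (Fin n) L) i j, IntermediateField.subset_adjoin _ _ ⟨(i, j), rfl⟩⟩
  have hgK : gK.map (algebraMap K' L) = g := rfl
  have hdet : gK.det ≠ 0 := by
    intro h
    have h1 : (g : Matrix (Fin n) (Fin n) L).det = 0 := by
      rw [← hgK, ← RingHom.mapMatrix_apply, ← RingHom.map_det, h, map_zero]
    exact ((Matrix.isUnit_iff_isUnit_det _).1 g.isUnit).ne_zero h1
  let g' : GL (Fin n) K' := Matrix.GeneralLinearGroup.mkOfDetNeZero gK hdet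
  have hg' : Matrix.GeneralLinearGroup.map (algebraMap K' L) g' = g := Units.ext hgK
  refine trdeg_adjoin_union s _ _ K' ?_ ?_ ?_
  · rw [IntermediateField.adjoin_le_iff]
    rintro _ ⟨p, rfl⟩
    have h := map_units_conj (algebraMap K' L) g' (jordanMatrix K' lam)
    rw [hg', jordanMatrix_map] at h
    have h' := congrFun (congrFun h p.1) p.2
    rw [Matrix.map_apply] at h'
    change conj g (jordanMatrix L lam) p.1 p.2 ∈ K'
    rw [conj, ← h']
    exact SetLike.coe_mem _
  · let X : Matrix (Fin n) (Fin n) (IntermediateField.adjoin k s) := Matrix.of fun i j =>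
      ⟨conj g (jordanMatrix L lam) i j, IntermediateField.subset_adjoin _ _ ⟨(i, j), rfl⟩⟩
    exact finrank_span_mulVec_le lam b X g w rfl hw
  · rw [← card_inSpan]
    have hwK : AlgebraicIndependent K' (fun a : {a // InSpan lam b a} => w a) :=
      (AlgebraicIndependent.sumElim_iff.1 hind).2.extendScalars K'
    -- `w = g⁻¹ y`, and `g⁻¹` has entries in `K'`.
    have hmem : ∀ a, w a ∈
        Algebra.adjoin K' (Set.range ((g : Matrix (Fin n) (Fin n) L) *ᵥ w)) := by
      intro a
      have h1 : w = ((g⁻¹ : GL (Fin n) L) : Matrix (Fin n) (Fin n) L) *ᵥ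
          ((g : Matrix (Fin n) (Fin n) L) *ᵥ w) := by
        rw [Matrix.mulVec_mulVec, ← Units.val_mul, inv_mul_cancel, Units.val_one,
          Matrix.one_mulVec]
      have h2 : ((g⁻¹ : GL (Fin n) L) : Matrix (Fin n) (Fin n) L) =
          ((g'⁻¹ : GL (Fin n) K') : Matrix (Fin n) (Fin n) K').map (algebraMap K' L) := by
        rw [← hg', ← map_inv]
        rfl
      have h3 : w a = ∑ i, algebraMap K' L
          (((g'⁻¹ : GL (Fin n) K') : Matrix (Fin n) (Fin n) K') a i) *
            ((g : Matrix (Fin n) (Fin n) L) *ᵥ w) i := by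
        conv_lhs => rw [h1, h2]
        rfl
      rw [h3]
      refine sum_mem fun i _ => mul_mem ?_ ?_
      · exact Subalgebra.algebraMap_mem _ _
      · exact Algebra.subset_adjoin ⟨i, rfl⟩
    let z : {a // InSpan lam b a} →
        Algebra.adjoin K' (Set.range ((g : Matrix (Fin n) (Fin n) L) *ᵥ w)) :=
      fun a => ⟨w a, hmem a⟩
    have hz : AlgebraicIndependent K' z :=
      AlgebraicIndependent.of_comp
        (Algebra.adjoin K' (Set.range ((g : Matrix (Fin n) (Fin n) L) *ᵥ w))).val hwK
    have := hz.lift_cardinalMk_le_trdeg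
    rw [Cardinal.mk_fintype] at this
    simpa using this

end Span

/-! ### Points of the enhanced orbit -/

section Points

variable {n : ℕ} (lam : n.Partition) {k : Type*} [Field k]

/-- The projection to the span of the boxes selected by `InSpan`. -/
def truncate {R : Type*} [Zero R] (b : ℕ) (p : Fin n → R) : Fin n → R :=
  fun a => if InSpan lam b a then p a else 0

theorem truncate_of_not {R : Type*} [Zero R] {b : ℕ} (p : Fin n → R) {a : Fin n}
    (h : ¬ InSpan lam b a) : truncate lam b p a = 0 :=
  if_neg h

theorem truncate_eq_self {R : Type*} [Zero R] {b : ℕ} {p : Fin n → R}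
    (h : ∀ a, ¬ InSpan lam b a → p a = 0) : truncate lam b p = p := by
  funext a
  unfold truncate
  split_ifs with ha
  · rfl
  · exact (h a ha).symm

/-- `g u - g J g⁻¹ v = g (u - J g⁻¹ v)`, and `u` is zero or ends a row of length `rowOrZero lam q`,
so the bracket lies in `Im J + Ker J ^ b`. -/
theorem exists_of_mem_enhancedOrbit {q : ℕ} {s : Matrix (Fin n) (Fin n) k × (Fin n → k)}
    (hs : s ∈ enhancedOrbit k lam q) :
    ∃ (g : GL (Fin n) k) (w : Fin n → k), (∀ a, ¬ InSpan lam (rowOrZero lam q) a → w a = 0) ∧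
      s = (conj g (jordanMatrix k lam), (g : Matrix (Fin n) (Fin n) k) *ᵥ w) := by
  obtain ⟨x, rfl⟩ := hs
  refine ⟨x.lin, typeVector k lam q - jordanMatrix k lam *ᵥ
    (((x.lin⁻¹ : GL (Fin n) k) : Matrix (Fin n) (Fin n) k) *ᵥ x.vec), ?_, ?_⟩
  · intro a ha
    obtain ⟨c, rfl⟩ := (boxEquiv lam).surjective a
    obtain ⟨h1, h2⟩ := (not_inSpan_box lam).1 ha
    rw [← coord_box lam (_ - _), coord_sub, coord_jordanMatrix_mulVec, coord_of_le lam _ h1.ge,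
      sub_zero, typeVector]
    split_ifs with hq
    · rw [coord_stringGenerator, if_neg]
      rintro ⟨h, -⟩
      rw [rowOrZero, dif_pos hq, h, row_lastEqualRow] at h2
      exact lt_irrefl _ h2
    · simp [coord]
  · change x • _ = _
    rw [smul_def, Matrix.mulVec_sub]
    simp only [conj, Matrix.mulVec_mulVec, Matrix.mul_assoc]
    rw [neg_add_eq_sub]

theorem conj_mem_enhancedOrbit {q : ℕ} {X : Matrix (Fin n) (Fin n) k} {w : Fin n → k}
    (h : (X, w) ∈ enhancedOrbit k lam q) (g : GL (Fin n) k) :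
    (conj g X, (g : Matrix (Fin n) (Fin n) k) *ᵥ w) ∈ enhancedOrbit k lam q := by
  have : (conj g X, (g : Matrix (Fin n) (Fin n) k) *ᵥ w) =
      (⟨g, 0⟩ : EnhancedGL n k) • (X, w) := by
    simp [smul_def]
  rw [this]
  exact MulAction.mem_orbit_of_mem_orbit _ h

/-- A nonempty open condition on `w` in `Im J + Ker J ^ b` that puts `(J, w)` into the enhanced
orbit. -/
theorem exists_polynomial_mem_enhancedOrbit (q : ℕ) :
    ∃ h : MvPolynomial (Fin n) k, h ≠ 0 ∧ ∀ p : Fin n → k, MvPolynomial.eval p h ≠ 0 →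
      (jordanMatrix k lam, truncate lam (rowOrZero lam q) p) ∈ enhancedOrbit k lam q := by
  by_cases hq : q < numRows lam
  · set i := lastEqualRow lam ⟨q, hq⟩ with hi
    have hb : rowOrZero lam q = row lam i := by
      rw [rowOrZero, dif_pos hq, hi, row_lastEqualRow]
    let e := boxEquiv lam ⟨i, ⟨row lam i - 1, Nat.sub_lt (row_pos lam i) one_pos⟩⟩
    have he : InSpan lam (row lam i) e := by
      by_contra h
      exact lt_irrefl _ ((not_inSpan_box lam).1 h).2
    -- The condition is that `w` be nonzero at the end of row `i`, which makes the centralizer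
    -- element `1 + N` invertible.
    refine ⟨MvPolynomial.X e, MvPolynomial.X_ne_zero e, fun p hp => ?_⟩
    rw [MvPolynomial.eval_X] at hp
    rw [hb]
    obtain ⟨c, hc, z, hz⟩ := exists_centralizer_mulVec_eq lam i
      (w := truncate lam (row lam i) p) (fun a ha => truncate_of_not lam p ha)
      (by change truncate lam (row lam i) p e ≠ 0; rwa [truncate, if_pos he])
    refine ⟨⟨c, -z⟩, ?_⟩
    change (⟨c, -z⟩ : EnhancedGL n k) • _ = _
    rw [smul_def, hc, typeVector, dif_pos hq, Matrix.mulVec_neg, neg_neg, add_comm, ← hi, hz]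
  -- Now `b = 0` and `u = 0`: the space is `Im J`, all of which is reached by translations, so no
  -- condition is needed.
  · refine ⟨1, one_ne_zero, fun p _ => ?_⟩
    have hb : rowOrZero lam q = 0 := by rw [rowOrZero, dif_neg hq]
    obtain ⟨z, hz⟩ := exists_jordanMatrix_mulVec_eq lam (x := truncate lam (rowOrZero lam q) p)
      (fun i r hr => coord_eq_zero_of_not_inSpan lam
        (fun a ha => truncate_of_not lam p ha) hr (by rw [hb]; exact row_pos lam i))
    refine ⟨⟨1, -z⟩, ?_⟩
    change (⟨1, -z⟩ : EnhancedGL n k) • _ = _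
    rw [smul_def, conj_one, typeVector, dif_neg hq, Matrix.mulVec_neg, neg_neg, Matrix.mulVec_zero,
      add_zero, hz]

end Points

/-! ### The generic points of the orbits -/

section Generic

variable (n : ℕ) (k : Type u) [Field k]

/-- The coordinate functions of pairs `(g, w)`. -/
abbrev PairIndex : Type := (Fin n × Fin n) ⊕ Fin n

/-- The generic matrix. -/
noncomputable def genericMatrix : Matrix (Fin n) (Fin n) (MvPolynomial (PairIndex n) k) :=
  Matrix.of fun i j => MvPolynomial.X (Sum.inl (i, j))

theorem det_genericMatrix_ne_zero : (genericMatrix n k).det ≠ 0 := by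
  intro h
  let p : PairIndex n → k := Sum.elim (fun c => (1 : Matrix (Fin n) (Fin n) k) c.1 c.2) 0
  have h1 : (genericMatrix n k).map (MvPolynomial.eval p) = 1 := by
    ext i j
    simp [genericMatrix, p]
  have h2 := congrArg (MvPolynomial.eval p) h
  rw [RingHom.map_det, RingHom.mapMatrix_apply, h1, Matrix.det_one, map_zero] at h2
  exact one_ne_zero h2

/-- The coordinate ring of `GL_n × kⁿ`. -/
abbrev PairRing : Type u := Localization.Away (genericMatrix n k).det

instance : IsDomain (PairRing n k) :=
  IsLocalization.isDomain_localization
    (powers_le_nonZeroDivisors_of_noZeroDivisors (det_genericMatrix_ne_zero n k))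

/-- The generic element of `GL_n`. -/
noncomputable def genericGL : GL (Fin n) (PairRing n k) :=
  Matrix.GeneralLinearGroup.mk'' ((genericMatrix n k).map (algebraMap _ (PairRing n k))) (by
    rw [← RingHom.mapMatrix_apply, ← RingHom.map_det]
    exact IsLocalization.Away.algebraMap_isUnit _)

/-- The coordinates of the generic vector. -/
noncomputable def vecVar (a : Fin n) : PairRing n k :=
  algebraMap (MvPolynomial (PairIndex n) k) (PairRing n k) (MvPolynomial.X (Sum.inr a))

variable {n} (lam : n.Partition)

/-- The generic point of the nilpotent orbit. -/
noncomputable def genericNilpotent : Matrix (Fin n) (Fin n) (PairRing n k) :=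
  (genericGL n k : Matrix (Fin n) (Fin n) (PairRing n k)) *
    (jordanMatrix k lam).map (algebraMap k (PairRing n k)) *
      (((genericGL n k)⁻¹ : GL (Fin n) (PairRing n k)) : Matrix (Fin n) (Fin n) (PairRing n k))

/-- The generic vector of `Im J + Ker J ^ b`. -/
noncomputable def genericTruncated (b : ℕ) : Fin n → PairRing n k :=
  truncate lam b (vecVar n k)

/-- The vector component of the generic point of the enhanced orbit. -/
noncomputable def genericVector (b : ℕ) : Fin n → PairRing n k :=
  (genericGL n k : Matrix (Fin n) (Fin n) (PairRing n k)) *ᵥ genericTruncated k lam b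

/-- Serves both for specialization to points over `k` and for embedding the generic point in the
fraction field. -/
theorem map_genericNilpotent {L : Type*} [Field L] [Algebra k L] (f : PairRing n k →ₐ[k] L) :
    (genericNilpotent k lam).map f =
      conj (Matrix.GeneralLinearGroup.map (f : PairRing n k →+* L) (genericGL n k))
        (jordanMatrix L lam) := by
  have h := map_units_conj (f : PairRing n k →+* L) (genericGL n k)
    ((jordanMatrix k lam).map (algebraMap k (PairRing n k)))
  rw [Matrix.map_map] at h
  have h2 : (jordanMatrix k lam).map ((f : PairRing n k →+* L) ∘ algebraMap k (PairRing n k)) =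
      jordanMatrix L lam := by
    rw [← jordanMatrix_map lam (algebraMap k L)]
    congr 1
    funext x
    exact f.commutes x
  rw [h2] at h
  exact h

theorem map_genericVector {L : Type*} [Field L] [Algebra k L] (b : ℕ) (f : PairRing n k →ₐ[k] L) :
    (fun i => f (genericVector k lam b i)) =
      (Matrix.GeneralLinearGroup.map (f : PairRing n k →+* L) (genericGL n k) :
        Matrix (Fin n) (Fin n) L) *ᵥ
          truncate lam b fun a => f (vecVar n k a) := by
  have h : (truncate lam b fun a => f (vecVar n k a)) =
      fun a => f (genericTruncated k lam b a) := by
    funext a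
    simp only [truncate, genericTruncated]
    split_ifs <;> simp
  rw [h]
  funext i
  exact RingHom.map_mulVec (f : PairRing n k →+* L) _ _ i

variable {k} in
theorem exists_eval_pair (g : GL (Fin n) k) (w : Fin n → k) :
    ∃ ev : PairRing n k →ₐ[k] k,
      Matrix.GeneralLinearGroup.map (ev : PairRing n k →+* k) (genericGL n k) = g ∧
      ∀ a, ev (vecVar n k a) = w a := by
  let p : PairIndex n → k := Sum.elim (fun c => (g : Matrix (Fin n) (Fin n) k) c.1 c.2) w
  have h1 : (genericMatrix n k).map (MvPolynomial.eval p) = g := by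
    ext i j
    simp [genericMatrix, p]
  obtain ⟨ev, hev⟩ := exists_eval_localizationAway (genericMatrix n k).det p (by
    rw [RingHom.map_det, RingHom.mapMatrix_apply, h1]
    exact ((Matrix.isUnit_iff_isUnit_det _).1 g.isUnit).ne_zero)
  refine ⟨ev, Units.ext ?_, fun a => ?_⟩
  · ext i j
    exact (hev _).trans (by simp [p, genericMatrix])
  · exact (hev _).trans (by simp [p])

/-- The matrix coordinates. -/
def matrixCoordinate (p : Fin n × Fin n) : Module.Dual k (Matrix (Fin n) (Fin n) k) :=
  Matrix.entryLinearMap k k p.1 p.2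

/-- The coordinates of pairs of a matrix and a vector. -/
def pairCoordinate :
    PairIndex n → Module.Dual k (Matrix (Fin n) (Fin n) k × (Fin n → k)) :=
  Sum.elim (fun p => (matrixCoordinate k p).comp (LinearMap.fst k _ _))
    fun a => (LinearMap.proj a).comp (LinearMap.snd k _ _)

theorem span_matrixCoordinate :
    Submodule.span k (Set.range (matrixCoordinate k (n := n))) = ⊤ := by
  rw [eq_top_iff]
  intro f _
  have : f = ∑ i, ∑ j, f (Matrix.single i j 1) • matrixCoordinate k (i, j) := by
    ext1 M
    conv_lhs => rw [Matrix.matrix_eq_sum_single M]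
    simp only [map_sum, LinearMap.sum_apply, LinearMap.smul_apply, matrixCoordinate,
      Matrix.entryLinearMap_apply]
    refine Finset.sum_congr rfl fun i _ => Finset.sum_congr rfl fun j _ => ?_
    rw [← mul_one (M i j), ← smul_eq_mul, ← Matrix.smul_single, map_smul]
    simp [mul_comm]
  rw [this]
  exact Submodule.sum_mem _ fun i _ => Submodule.sum_mem _ fun j _ =>
    Submodule.smul_mem _ _ (Submodule.subset_span ⟨(i, j), rfl⟩)

theorem span_pairCoordinate :
    Submodule.span k (Set.range (pairCoordinate k (n := n))) = ⊤ := by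
  rw [eq_top_iff]
  intro f _
  have hf : f = (f.comp (LinearMap.inl k _ _)).comp (LinearMap.fst k _ _) +
      ∑ a, f (0, Pi.single a 1) • pairCoordinate k (Sum.inr a) := by
    apply LinearMap.ext
    rintro ⟨M, v⟩
    have h1 : ((M, v) : Matrix (Fin n) (Fin n) k × (Fin n → k)) =
        (M, 0) + ∑ a, v a • (0, Pi.single a 1) := by
      refine Prod.ext ?_ ?_
      · simp [Prod.fst_sum]
      · simpa [Prod.snd_sum] using (pi_eq_sum_univ' v)
    conv_lhs => rw [h1]
    have h2 : ∀ a, f (0, v a • Pi.single a 1) = v a * f (0, Pi.single a 1) := by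
      intro a
      rw [← smul_eq_mul, ← map_smul, Prod.smul_mk, smul_zero]
    simp [pairCoordinate, map_sum, LinearMap.sum_apply, mul_comm, h2]
  rw [hf]
  refine Submodule.add_mem _ ?_ (Submodule.sum_mem _ fun a _ =>
    Submodule.smul_mem _ _ (Submodule.subset_span ⟨Sum.inr a, rfl⟩))
  have h2 : f.comp (LinearMap.inl k _ _) ∈
      Submodule.span k (Set.range (matrixCoordinate k (n := n))) := by
    rw [span_matrixCoordinate]
    trivial
  have h3 := Submodule.mem_map_of_mem (f := (LinearMap.fst k (Matrix (Fin n) (Fin n) k)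
    (Fin n → k)).dualMap) h2
  rw [Submodule.map_span] at h3
  refine Submodule.span_mono ?_ h3
  rintro _ ⟨_, ⟨p, rfl⟩, rfl⟩
  exact ⟨Sum.inl p, rfl⟩

variable [Infinite k]

theorem isGenericPoint_nilpotentOrbit :
    IsGenericPoint (nilpotentOrbit k lam) (matrixCoordinate k)
      (fun p => genericNilpotent k lam p.1 p.2) where
  exists_eval := by
    rintro _ ⟨g, rfl⟩
    obtain ⟨ev, hev, -⟩ := exists_eval_pair g 0
    refine ⟨ev, fun p => ?_⟩
    have h := congrFun (congrFun (map_genericNilpotent k lam ev) p.1) p.2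
    rw [hev] at h
    exact h.symm
  eq_zero := by
    intro z hz
    refine localizationAway_eq_zero _ 1 (det_genericMatrix_ne_zero n k) one_ne_zero z
      fun ev _ => hz ev ⟨_, ⟨Matrix.GeneralLinearGroup.map (ev : PairRing n k →+* k)
        (genericGL n k), rfl⟩, fun p => ?_⟩
    exact (congrFun (congrFun (map_genericNilpotent k lam ev) p.1) p.2).symm

/-- Every orbit point is a specialization of the pair, but a specialization need not lie in the
orbit. It does on a nonempty principal open set, which is enough to separate elements of the ring.
-/
theorem isGenericPoint_enhancedOrbit (q : ℕ) :
    IsGenericPoint (enhancedOrbit k lam q) (pairCoordinate k)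
      (Sum.elim (fun p => genericNilpotent k lam p.1 p.2)
        (genericVector k lam (rowOrZero lam q))) where
  exists_eval := by
    intro s hs
    obtain ⟨g, w, hw, rfl⟩ := exists_of_mem_enhancedOrbit lam hs
    obtain ⟨ev, hev, hev'⟩ := exists_eval_pair g w
    refine ⟨ev, ?_⟩
    rintro (p | a)
    · have h := congrFun (congrFun (map_genericNilpotent k lam ev) p.1) p.2
      rw [hev] at h
      exact h.symm
    · have h := congrFun (map_genericVector k lam (rowOrZero lam q) ev) a
      rw [hev, funext hev', truncate_eq_self lam hw] at h
      exact h.symm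
  eq_zero := by
    intro z hz
    obtain ⟨h, h0, hmem⟩ := exists_polynomial_mem_enhancedOrbit lam (k := k) q
    refine localizationAway_eq_zero _ (MvPolynomial.rename Sum.inr h)
      (det_genericMatrix_ne_zero n k)
      (fun h' => h0 (MvPolynomial.rename_injective _ Sum.inr_injective (by rw [h', map_zero]))) z
      fun ev hev => hz ev ⟨_, conj_mem_enhancedOrbit lam (hmem
        (fun a => ev (vecVar n k a)) ?_)
          (Matrix.GeneralLinearGroup.map (ev : PairRing n k →+* k) (genericGL n k)), ?_⟩
    · have h1 : ev (algebraMap (MvPolynomial (PairIndex n) k) _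
          (MvPolynomial.rename Sum.inr h)) = MvPolynomial.eval (fun a => ev (vecVar n k a)) h := by
        let ψ : MvPolynomial (PairIndex n) k →ₐ[k] k :=
          ev.comp (IsScalarTower.toAlgHom k (MvPolynomial (PairIndex n) k) (PairRing n k))
        have h2 : ψ.comp (MvPolynomial.rename Sum.inr) = MvPolynomial.aeval
            (fun a => ev (vecVar n k a)) := by
          apply MvPolynomial.algHom_ext
          intro a
          simp [ψ, vecVar]
        have h3 := DFunLike.congr_fun h2 h
        exact h3.trans (DFunLike.congr_fun (MvPolynomial.coe_aeval_eq_eval _) h)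
      rwa [← h1]
    · rintro (p | a)
      · exact (congrFun (congrFun (map_genericNilpotent k lam ev) p.1) p.2).symm
      · exact (congrFun (map_genericVector k lam (rowOrZero lam q) ev) a).symm

theorem dimension_enhancedOrbit {q : ℕ} (hq : IsEnhancedPartition lam q) :
    dimension k (enhancedOrbit k lam q) =
      dimension k (nilpotentOrbit k lam) + ((n - q : ℕ) : WithBot ℕ∞) := by
  let L := FractionRing (PairRing n k)
  let f : PairRing n k →ₐ[k] L := IsScalarTower.toAlgHom k (PairRing n k) L
  have hf : Function.Injective f := IsFractionRing.injective (PairRing n k) L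
  have hR : Function.Injective (algebraMap (MvPolynomial (PairIndex n) k) (PairRing n k)) :=
    IsLocalization.injective _
      (powers_le_nonZeroDivisors_of_noZeroDivisors (det_genericMatrix_ne_zero n k))
  set b := rowOrZero lam q with hb
  let g : GL (Fin n) L := Matrix.GeneralLinearGroup.map (f : PairRing n k →+* L) (genericGL n k)
  let w : Fin n → L := truncate lam b fun a => f (vecVar n k a)
  have hind : AlgebraicIndependent k (Sum.elim (fun a : {a // InSpan lam b a} => w a)
      fun p : Fin n × Fin n => (g : Matrix (Fin n) (Fin n) L) p.1 p.2) := by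
    let ψ : MvPolynomial (PairIndex n) k →ₐ[k] L :=
      f.comp (IsScalarTower.toAlgHom k (MvPolynomial (PairIndex n) k) (PairRing n k))
    -- The selected coordinates of `w` and the entries of `g` are distinct variables, embedded
    -- injectively in `L`.
    have h1 := ((MvPolynomial.algebraicIndependent_X (PairIndex n) k).map' (f := ψ)
      (hf.comp hR)).comp (Sum.elim (fun a : {a // InSpan lam b a} => Sum.inr a.1) Sum.inl)
        (by
          rintro (a | a) (c | c) h
          · exact congrArg _ (Subtype.ext (Sum.inr_injective h))
          · exact absurd h (by simp)
          · exact absurd h (by simp)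
          · exact congrArg _ (Sum.inl_injective h))
    convert h1 using 1
    funext x
    rcases x with a | p
    · exact if_pos a.2
    · rfl
  have htr := trdeg_adjoin_conj_union lam b g w (fun a ha => truncate_of_not lam _ ha) hind
  -- The codimension of `Im J + Ker J ^ b`, the number of rows longer than `b`, becomes `q`.
  rw [card_row_gt lam hq] at htr
  have hN := isGenericPoint_nilpotentOrbit k lam
  have hE := isGenericPoint_enhancedOrbit k lam q
  rw [hN.dimension_eq (span_matrixCoordinate k), hE.dimension_eq (span_pairCoordinate k)]
  have hX := map_genericNilpotent k lam f
  have hy := map_genericVector k lam b f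
  have hxN : (f ∘ fun p : Fin n × Fin n => genericNilpotent k lam p.1 p.2) =
      fun p : Fin n × Fin n => conj g (jordanMatrix L lam) p.1 p.2 := by
    funext p
    exact congrFun (congrFun hX p.1) p.2
  have hxE : Set.range (f ∘ Sum.elim (fun p : Fin n × Fin n => genericNilpotent k lam p.1 p.2)
        (genericVector k lam b)) =
      (Set.range fun p : Fin n × Fin n => conj g (jordanMatrix L lam) p.1 p.2) ∪
        Set.range ((g : Matrix (Fin n) (Fin n) L) *ᵥ w) := by
    rw [Sum.comp_elim, Set.Sum.elim_range, hxN]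
    congr 2
  have hfg : ∀ {ι : Type} [Finite ι] (x : ι → PairRing n k),
      Algebra.FiniteType k (Algebra.adjoin k (Set.range x)) := fun x =>
    Algebra.FiniteType.adjoin_of_finite (Set.finite_range x)
  have := hfg (fun p : Fin n × Fin n => genericNilpotent k lam p.1 p.2)
  have := hfg (Sum.elim (fun p : Fin n × Fin n => genericNilpotent k lam p.1 p.2)
    (genericVector k lam b))
  apply ringKrullDim_eq_add_of_trdeg (k := k)
  obtain ⟨e1⟩ := nonempty_algEquiv_adjoin_map f hf
    (fun p : Fin n × Fin n => genericNilpotent k lam p.1 p.2)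
  obtain ⟨e2⟩ := nonempty_algEquiv_adjoin_map f hf
    (Sum.elim (fun p : Fin n × Fin n => genericNilpotent k lam p.1 p.2) (genericVector k lam b))
  rw [e1.trdeg_eq, e2.trdeg_eq, hxN, hxE]
  exact htr

end Generic

end Enhanced

theorem mainTheorem6 {k : Type*} [Field k] [IsAlgClosed k] (n : ℕ) (lam : n.Partition) (q : ℕ)
    (hq : Enhanced.IsEnhancedPartition lam q) :
    Enhanced.dimension k (Enhanced.enhancedOrbit k lam q) =
      Enhanced.dimension k (Enhanced.nilpotentOrbit k lam) + ((n - q : ℕ) : WithBot ℕ∞) := by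
  have : Infinite k := IsAlgClosed.instInfinite
  exact Enhanced.dimension_enhancedOrbit k lam hq
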